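/- Let $\Sigma$ be a finite alphabet and consider languages $L\subseteq\Sigma^\omega$ of infinite words. Monadic second-order logic with the unbounding quantifier (MSO+U) has variables for positions $x\in\mathbb N$ and for sets $X\subseteq\mathbb N$ of positions, the atomic formulas $a(x)$ (position $x$ carries the letter $a\in\Sigma$), $x\le y$ and $x\in X$, boolean connectives, quantification over positions, quantification over sets of positions, and the quantifier $UX.\varphi(X)$, which says that for every $n\in\mathbb N$ some finite set $X$ with $|X|\ge n$ satisfies $\varphi(X)$. In full MSO+U the quantifiers $\exists X,\forall X$ range over all sets of positions, in weak MSO+U only over the finite ones. A nondeterministic max-automaton has a finite set of states, some of them initial, a finite set of counters with values in $\mathbb N$, all initially $0$, and a finite set of transitions, each of which reads a letter, changes the state and executes a finite sequence of the operations $c:=c+1$, $c:=0$, $\mathit{output}(c)$, $c:=\max(c,d)$. It accepts an infinite word if some run on it, starting in an initial state, satisfies the acceptance condition, a boolean combination of clauses "the sequence of values output on counter $c$ is bounded". Then full MSO+U is strictly more expressive than weak MSO+U over infinite words: 1. every language $L\subseteq\Sigma^\omega$ definable by a sentence of weak MSO+U is definable by a sentence of full MSO+U; 2. if $\Sigma$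 has at least two letters, then some language $L\subseteq\Sigma^\omega$ is definable by a sentence of full MSO+U but not by a sentence of weak MSO+U. Moreover, 3. every language $L\subseteq\Sigma^\omega$ recognized by a nondeterministic max-automaton is definable by a sentence of full MSO+U. -/

import Mathlib

universe u

/-! Monadic second-order logic with the unbounding quantifier over infinite words `w : ℕ → α`. -/

namespace MSOU

/-- Formulas of monadic second-order logic with the unbounding quantifier, over the alphabet `α`,
with `n` free first-order (position) variables and `m` free set variables. The quantifiers bind
variable `0`. The remaining connectives and quantifiers are the usual abbreviations. -/
inductive Formula (α : Type u) : ℕ → ℕ → Type u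
  /-- position `x` carries the letter `a` -/
  | letter {n m : ℕ} (a : α) (x : Fin n) : Formula α n m
  /-- `x ≤ y` -/
  | le {n m : ℕ} (x y : Fin n) : Formula α n m
  /-- `x ∈ X` -/
  | mem {n m : ℕ} (x : Fin n) (X : Fin m) : Formula α n m
  | not {n m : ℕ} (φ : Formula α n m) : Formula α n m
  | and {n m : ℕ} (φ ψ : Formula α n m) : Formula α n m
  /-- `∃ x, φ` -/
  | existsPos {n m : ℕ} (φ : Formula α (n + 1) m) : Formula α n m
  /-- `∃ X, φ` -/
  | existsSet {n m : ℕ} (φ : Formula α n (m + 1)) : Formula α n m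
  /-- `U X, φ` -/
  | unbounding {n m : ℕ} (φ : Formula α n (m + 1)) : Formula α n m

/-- Satisfaction in the infinite word `w`, under a valuation `p` of the position variables and `S`
of the set variables, when the quantifier `∃ X` ranges over the sets of positions in `D`.
The quantifier `U X` says that there are finite sets `X` of arbitrarily large size that
satisfy `φ`. -/
def Formula.Sat {α : Type u} (D : Set (Set ℕ)) (w : ℕ → α) :
    {n m : ℕ} → Formula α n m → (Fin n → ℕ) → (Fin m → Set ℕ) → Prop
  | _, _, .letter a x, p, _ => w (p x) = a
  | _, _, .le x y, p, _ => p x ≤ p y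
  | _, _, .mem x X, p, S => p x ∈ S X
  | _, _, .not φ, p, S => ¬ φ.Sat D w p S
  | _, _, .and φ ψ, p, S => φ.Sat D w p S ∧ ψ.Sat D w p S
  | _, _, .existsPos φ, p, S => ∃ x : ℕ, φ.Sat D w (Fin.cons x p) S
  | _, _, .existsSet φ, p, S => ∃ X ∈ D, φ.Sat D w p (Fin.cons X S)
  | _, _, .unbounding φ, p, S =>
      ∀ k : ℕ, ∃ X : Set ℕ, φ.Sat D w p (Fin.cons X S) ∧ X.Finite ∧ k ≤ X.ncard

/-- The language of infinite words defined by a sentence. -/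
def Formula.language {α : Type u} (D : Set (Set ℕ)) (φ : Formula α 0 0) : Set (ℕ → α) :=
  {w | φ.Sat D w Fin.elim0 Fin.elim0}

/-- `L` is definable in full MSO with the unbounding quantifier: `∃ X` ranges over all sets. -/
def FullDefinable {α : Type u} (L : Set (ℕ → α)) : Prop :=
  ∃ φ : Formula α 0 0, φ.language Set.univ = L

/-- `L` is definable in weak MSO with the unbounding quantifier: `∃ X` ranges over finite sets. -/
def WeakDefinable {α : Type u} (L : Set (ℕ → α)) : Prop :=
  ∃ φ : Formula α 0 0, φ.language {X | X.Finite} = L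

end MSOU

/-! Nondeterministic max-automata. -/

namespace MaxAut

/-- The counter operations over a set `C` of counters. -/
inductive Op (C : Type) : Type
  /-- `c := c + 1` -/
  | incr (c : C) : Op C
  /-- `c := 0` -/
  | reset (c : C) : Op C
  /-- output the value of `c` -/
  | output (c : C) : Op C
  /-- `c := max (c, d)` -/
  | max (c d : C) : Op C

open Classical in
/-- The effect of a counter operation on the counter values. -/
noncomputable def Op.apply {C : Type} (v : C → ℕ) : Op C → (C → ℕ)
  | .incr c => Function.update v c (v c + 1)
  | .reset c => Function.update v c 0
  | .output _ => v
  | .max c d => Function.update v c (Max.max (v c) (v d))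

/-- The counter values after a finite sequence of operations, executed from left to right. -/
noncomputable def exec {C : Type} (ops : List (Op C)) (v : C → ℕ) : C → ℕ :=
  ops.foldl Op.apply v

/-- The pairs (counter, value) that are output during a finite sequence of operations that is
started with the counter values `v`. -/
noncomputable def outputs {C : Type} : List (Op C) → (C → ℕ) → List (C × ℕ)
  | [], _ => []
  | .output c :: ops, v => (c, v c) :: outputs ops v
  | op :: ops, v => outputs ops (op.apply v)

/-- Boolean combinations of the clauses "the sequence output on counter `c` is bounded". -/
inductive Cond (C : Type) : Type
  | bounded (c : C) : Cond C
  | true : Cond C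
  | not (φ : Cond C) : Cond C
  | and (φ ψ : Cond C) : Cond C

/-- Truth of an acceptance condition, where `B` is the set of the counters with bounded output. -/
def Cond.Holds {C : Type} (B : Set C) : Cond C → Prop
  | .bounded c => c ∈ B
  | .true => True
  | .not φ => ¬ φ.Holds B
  | .and φ ψ => φ.Holds B ∧ ψ.Holds B

/-- A transition from state `src` to state `tgt` that reads `letter` and executes `ops`. -/
structure Transition (α : Type u) (Q C : Type) : Type u where
  src : Q
  letter : α
  ops : List (Op C)
  tgt : Q

/-- A nondeterministic max-automaton with input alphabet `α`, states `Q` and counters `C`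
(where `Q` and `C` are to be finite). -/
structure MaxAutomaton (α : Type u) (Q C : Type) : Type u where
  initial : Set Q
  transitions : Set (Transition α Q C)
  finite_transitions : transitions.Finite
  acc : Cond C

variable {α : Type u} {Q C : Type}

/-- `ρ` is a run of the automaton `A` on the infinite word `w`. -/
structure MaxAutomaton.IsRun (A : MaxAutomaton α Q C) (w : ℕ → α)
    (ρ : ℕ → Transition α Q C) : Prop where
  start : (ρ 0).src ∈ A.initial
  mem : ∀ i, ρ i ∈ A.transitions
  reads : ∀ i, (ρ i).letter = w i
  next : ∀ i, (ρ i).tgt = (ρ (i + 1)).src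

/-- The counter values before the `i`-th transition of `ρ`; all counters start with `0`. -/
noncomputable def counterVal (ρ : ℕ → Transition α Q C) : ℕ → (C → ℕ)
  | 0 => fun _ => 0
  | i + 1 => exec (ρ i).ops (counterVal ρ i)

/-- The set of all values that are output on counter `c` along `ρ`. -/
def outputValues (ρ : ℕ → Transition α Q C) (c : C) : Set ℕ :=
  {k | ∃ i, (c, k) ∈ outputs (ρ i).ops (counterVal ρ i)}

/-- The infinite words on which the automaton has a run that satisfies the acceptance condition. -/
def MaxAutomaton.language (A : MaxAutomaton α Q C) : Set (ℕ → α) :=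
  {w | ∃ ρ, A.IsRun w ρ ∧ A.acc.Holds {c | BddAbove (outputValues ρ c)}}

/-- `L` is recognized by a nondeterministic max-automaton. -/
def Recognizable {α : Type u} (L : Set (ℕ → α)) : Prop :=
  ∃ (Q C : Type) (_ : Finite Q) (_ : Finite C) (A : MaxAutomaton α Q C), A.language = L

end MaxAut

/-! Weak formulas embed into the full logic because a set of positions is finite iff it is bounded,
so set quantifiers can be relativized.

For the separation, weakly definable languages are Borel: position quantifiers and finite-set
quantifiers are countable unions, and `U` is a countable intersection of such unions
(`WeakDefinable.measurableSet`). The full logic escapes this class. A sequence of naturals is coded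
by finite sets of its first elements, each written as a block of letters `a`. Deep nodes whose
elements at every level are bounded yield an infinite branch by compactness. Both depth (number of
letters) and size (distance from the start of the block) are measured by `U`, so `branchLanguage`
expresses the existence of a branch. This pulls `branchLanguage` back along a Borel map to
`branchSet` (`word_mem_branchLanguage_iff`), which is not Borel by a diagonal argument
(`not_measurableSet_branchSet`).

For max-automata, a run is guessed as a labelling of positions. A counter value is the maximal gain
along a path through the counters, and one transition gains at most a constant `M`. So up to the
factor `M` it counts the gaining positions of a trace, and `U` over these sets of positions
expresses unboundedness (`not_bddAbove_outputValues_iff`). -/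

/-! ### Derived connectives and relativization to finite sets -/

namespace MSOU.Formula

variable {α : Type u} {n m : ℕ} {D : Set (Set ℕ)}

/-- Implication. -/
def imp (φ ψ : Formula α n m) : Formula α n m := not (and φ (not ψ))

/-- Disjunction. -/
def or (φ ψ : Formula α n m) : Formula α n m := not (and (not φ) (not ψ))

/-- `∀ x, φ`. -/
def allPos (φ : Formula α (n + 1) m) : Formula α n m := not (existsPos (not φ))

/-- `∀ X, φ`. -/
def allSet (φ : Formula α n (m + 1)) : Formula α n m := not (existsSet (not φ))

/-- `x < y`. -/
def lt (x y : Fin n) : Formula α n m := not (le y x)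

/-- `y = x + 1`. -/
def succ (x y : Fin n) : Formula α n m :=
  and (lt x y) (not (existsPos (and (lt x.succ 0) (lt 0 y.succ))))

/-- `x = 0`. -/
def first (x : Fin n) : Formula α n m := allPos (le x.succ 0)

/-- The set `X` is bounded. -/
def isFinite (X : Fin m) : Formula α n m :=
  existsPos (allPos (imp (mem 0 X) (le 0 1)))

section Sat

variable {w : ℕ → α} {p : Fin n → ℕ} {S : Fin m → Set ℕ}

@[simp] theorem sat_letter {a : α} {x : Fin n} :
    (letter a x : Formula α n m).Sat D w p S ↔ w (p x) = a := Iff.rfl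

@[simp] theorem sat_le {x y : Fin n} :
    (le x y : Formula α n m).Sat D w p S ↔ p x ≤ p y := Iff.rfl

@[simp] theorem sat_mem {x : Fin n} {X : Fin m} :
    (mem x X : Formula α n m).Sat D w p S ↔ p x ∈ S X := Iff.rfl

@[simp] theorem sat_not {φ : Formula α n m} : φ.not.Sat D w p S ↔ ¬ φ.Sat D w p S := Iff.rfl

@[simp] theorem sat_and {φ ψ : Formula α n m} :
    (φ.and ψ).Sat D w p S ↔ φ.Sat D w p S ∧ ψ.Sat D w p S := Iff.rfl

@[simp] theorem sat_existsPos {φ : Formula α (n + 1) m} :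
    φ.existsPos.Sat D w p S ↔ ∃ x, φ.Sat D w (Fin.cons x p) S := Iff.rfl

@[simp] theorem sat_existsSet {φ : Formula α n (m + 1)} :
    φ.existsSet.Sat D w p S ↔ ∃ X ∈ D, φ.Sat D w p (Fin.cons X S) := Iff.rfl

@[simp] theorem sat_unbounding {φ : Formula α n (m + 1)} :
    φ.unbounding.Sat D w p S ↔
      ∀ k : ℕ, ∃ X : Set ℕ, φ.Sat D w p (Fin.cons X S) ∧ X.Finite ∧ k ≤ X.ncard := Iff.rfl

@[simp] theorem sat_imp {φ ψ : Formula α n m} :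
    (φ.imp ψ).Sat D w p S ↔ (φ.Sat D w p S → ψ.Sat D w p S) := by
  simp [imp]

@[simp] theorem sat_or {φ ψ : Formula α n m} :
    (φ.or ψ).Sat D w p S ↔ (φ.Sat D w p S ∨ ψ.Sat D w p S) := by
  simp [or, imp_iff_not_or]

@[simp] theorem sat_allPos {φ : Formula α (n + 1) m} :
    φ.allPos.Sat D w p S ↔ ∀ x, φ.Sat D w (Fin.cons x p) S := by
  simp [allPos]

@[simp] theorem sat_allSet {φ : Formula α n (m + 1)} :
    φ.allSet.Sat D w p S ↔ ∀ X ∈ D, φ.Sat D w p (Fin.cons X S) := by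
  simp [allSet]

@[simp] theorem sat_lt {x y : Fin n} :
    (lt x y : Formula α n m).Sat D w p S ↔ p x < p y := by
  simp [lt]

@[simp] theorem sat_succ {x y : Fin n} :
    (succ x y : Formula α n m).Sat D w p S ↔ p y = p x + 1 := by
  simp only [succ, sat_and, sat_lt, sat_not, sat_existsPos, Fin.cons_succ, Fin.cons_zero]
  constructor
  · rintro ⟨h, h'⟩
    by_contra hne
    exact h' ⟨p x + 1, by omega, by omega⟩
  · intro h
    exact ⟨by omega, fun ⟨z, hz, hz'⟩ => by omega⟩

@[simp] theorem sat_first {x : Fin n} :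
    (first x : Formula α n m).Sat D w p S ↔ p x = 0 := by
  simp only [first, sat_allPos, sat_le, Fin.cons_succ, Fin.cons_zero]
  exact ⟨fun h => Nat.le_zero.1 (h 0), fun h y => h ▸ Nat.zero_le y⟩

@[simp] theorem sat_isFinite {X : Fin m} :
    (isFinite X : Formula α n m).Sat D w p S ↔ (S X).Finite := by
  rw [Set.finite_iff_bddAbove]
  simp [isFinite, bddAbove_def, Fin.cons_one]

end Sat

/-- The translation of weak MSO+U to full MSO+U: set quantifiers are relativized to the finite
sets. -/
def relativize : {n m : ℕ} → Formula α n m → Formula α n m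
  | _, _, letter a x => letter a x
  | _, _, le x y => le x y
  | _, _, mem x X => mem x X
  | _, _, not φ => not φ.relativize
  | _, _, and φ ψ => and φ.relativize ψ.relativize
  | _, _, existsPos φ => existsPos φ.relativize
  | _, _, existsSet φ => existsSet (and (isFinite 0) φ.relativize)
  | _, _, unbounding φ => unbounding φ.relativize

theorem sat_relativize (w : ℕ → α) : ∀ {n m : ℕ} (φ : Formula α n m) (p : Fin n → ℕ)
    (S : Fin m → Set ℕ), φ.relativize.Sat Set.univ w p S ↔ φ.Sat {X | X.Finite} w p S
  | _, _, letter a x, p, S => Iff.rfl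
  | _, _, le x y, p, S => Iff.rfl
  | _, _, mem x X, p, S => Iff.rfl
  | _, _, not φ, p, S => by simp [relativize, sat_relativize w φ]
  | _, _, and φ ψ, p, S => by simp [relativize, sat_relativize w φ, sat_relativize w ψ]
  | _, _, existsPos φ, p, S => by simp [relativize, sat_relativize w φ]
  | _, _, existsSet φ, p, S => by simp [relativize, sat_relativize w φ]
  | _, _, unbounding φ, p, S => by simp [relativize, sat_relativize w φ]

/-! ### Finite disjunctions and quantification over labellings -/

/-- The empty disjunction is `¬ x ≤ x`, which needs a free position variable; hence `0 < n`. -/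
theorem exists_sat_iff_exists_fintype {ι : Type*} [Finite ι] (φ : ι → Formula α n m)
    (hn : 0 < n) :
    ∃ ψ : Formula α n m, ∀ D w p S, ψ.Sat D w p S ↔ ∃ i, (φ i).Sat D w p S := by
  have := Fintype.ofFinite ι
  suffices h : ∀ s : Finset ι, ∃ ψ : Formula α n m, ∀ D w p S,
      ψ.Sat D w p S ↔ ∃ i ∈ s, (φ i).Sat D w p S by simpa using h Finset.univ
  classical
  intro s
  induction s using Finset.induction_on with
  | empty => exact ⟨not (le ⟨0, hn⟩ ⟨0, hn⟩), by simp⟩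
  | insert i s _ ih =>
    obtain ⟨ψ, hψ⟩ := ih
    exact ⟨or (φ i) ψ, by simp [hψ]⟩

theorem exists_sat_iff_forall_fintype {ι : Type*} [Finite ι] (φ : ι → Formula α n m)
    (hn : 0 < n) :
    ∃ ψ : Formula α n m, ∀ D w p S, ψ.Sat D w p S ↔ ∀ i, (φ i).Sat D w p S := by
  obtain ⟨ψ, hψ⟩ := exists_sat_iff_exists_fintype (fun i => not (φ i)) hn
  exact ⟨not ψ, by simp [hψ]⟩

/-- The labels of the positions `x` and `y` are in the relation `R`. -/
noncomputable def labels [Finite α] (R : α → α → Prop) (x y : Fin n) : Formula α n m :=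
  (exists_sat_iff_exists_fintype (fun i : {i : α × α // R i.1 i.2} =>
    and (letter i.1.1 x) (letter i.1.2 y)) x.pos).choose

@[simp] theorem sat_labels [Finite α] {R : α → α → Prop} {x y : Fin n} {w : ℕ → α}
    {p : Fin n → ℕ} {S : Fin m → Set ℕ} :
    (labels R x y : Formula α n m).Sat D w p S ↔ R (w (p x)) (w (p y)) := by
  rw [labels, (exists_sat_iff_exists_fintype (fun i : {i : α × α // R i.1 i.2} =>
    (and (letter i.1.1 x) (letter i.1.2 y) : Formula α n m)) x.pos).choose_spec]
  simp

/-- Translation of a formula about words over a product alphabet, where the second component of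
the letters is given by sets. -/
theorem exists_sat_prod {κ : Type*} : ∀ {n m : ℕ} (φ : Formula (α × κ) n m) {M : ℕ}
    (g : Fin m → Fin M) (h : κ → Fin M), ∃ ψ : Formula α n M, ∀ (w : ℕ → α) (δ : ℕ → κ)
    (p : Fin n → ℕ) (S : Fin M → Set ℕ), (∀ d, S (h d) = {i | δ i = d}) →
      (ψ.Sat D w p S ↔ φ.Sat D (fun i => (w i, δ i)) p (S ∘ g)) := by
  -- Under a set quantifier both contexts gain a variable `0`, and the renaming `g` is shifted past
  -- it.
  have key {m M : ℕ} (g : Fin m → Fin M) (X : Set ℕ) (S : Fin M → Set ℕ) :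
      (Fin.cons X S : Fin (M + 1) → Set ℕ) ∘ (Fin.cons 0 (Fin.succ ∘ g) : Fin (m + 1) → Fin (M + 1))
        = Fin.cons X (S ∘ g) := by
    funext i
    refine Fin.cases ?_ (fun i => ?_) i <;> simp
  intro n m φ
  induction φ with
  | letter a x =>
    intro M g h
    refine ⟨and (letter a.1 x) (mem x (h a.2)), fun w δ p S hS => ?_⟩
    simp [hS, Prod.ext_iff]
  | le x y => exact fun g h => ⟨le x y, fun _ _ _ _ _ => Iff.rfl⟩
  | mem x X => exact fun g h => ⟨mem x (g X), fun _ _ _ _ _ => Iff.rfl⟩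
  | not φ ih =>
    intro M g h
    obtain ⟨ψ, hψ⟩ := ih g h
    exact ⟨not ψ, fun w δ p S hS => by simp [hψ w δ p S hS]⟩
  | and φ φ' ih ih' =>
    intro M g h
    obtain ⟨ψ, hψ⟩ := ih g h
    obtain ⟨ψ', hψ'⟩ := ih' g h
    exact ⟨and ψ ψ', fun w δ p S hS => by simp [hψ w δ p S hS, hψ' w δ p S hS]⟩
  | existsPos φ ih =>
    intro M g h
    obtain ⟨ψ, hψ⟩ := ih g h
    exact ⟨existsPos ψ, fun w δ p S hS => by simp [hψ w δ _ S hS]⟩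
  | existsSet φ ih =>
    intro M g h
    obtain ⟨ψ, hψ⟩ := ih (Fin.cons 0 (Fin.succ ∘ g)) (Fin.succ ∘ h)
    refine ⟨existsSet ψ, fun w δ p S hS => ?_⟩
    simp only [sat_existsSet, ← key]
    exact exists_congr fun X => and_congr_right fun _ => hψ w δ p _ (by simpa using hS)
  | unbounding φ ih =>
    intro M g h
    obtain ⟨ψ, hψ⟩ := ih (Fin.cons 0 (Fin.succ ∘ g)) (Fin.succ ∘ h)
    refine ⟨unbounding ψ, fun w δ p S hS => ?_⟩
    simp only [sat_unbounding, ← key]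
    exact forall_congr' fun _ => exists_congr fun X => and_congr_left fun _ =>
      hψ w δ p _ (by simpa using hS)

/-- Quantification over `k` sets. -/
def existsSets : (k : ℕ) → Formula α n (m + k) → Formula α n m
  | 0, φ => φ
  | k + 1, φ => existsSets k (existsSet φ)

theorem sat_existsSets {w : ℕ → α} {p : Fin n → ℕ} {S : Fin m → Set ℕ} :
    ∀ (k : ℕ) (φ : Formula α n (m + k)), (existsSets k φ).Sat Set.univ w p S ↔
      ∃ S' : Fin (m + k) → Set ℕ, (∀ i : Fin m, S' (i.addNat k) = S i) ∧ φ.Sat Set.univ w p S'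
  | 0, φ => by
    refine ⟨fun h => ⟨S, fun _ => rfl, h⟩, fun ⟨S', hS', h⟩ => ?_⟩
    obtain rfl : S' = S := funext hS'
    exact h
  | k + 1, φ => by
    rw [existsSets, sat_existsSets k]
    simp only [sat_existsSet, Set.mem_univ, true_and]
    constructor
    · rintro ⟨S', hS', X, h⟩
      exact ⟨Fin.cons X S', fun i => hS' i, h⟩
    · rintro ⟨S', hS', h⟩
      refine ⟨Fin.tail S', fun i => hS' i, S' 0, ?_⟩
      rwa [Fin.cons_self_tail]

/-- Quantification over functions from the positions to a finite type. -/
theorem exists_sat_iff_exists_fun {κ : Type*} [Finite κ] (φ : Formula (α × κ) n m) :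
    ∃ ψ : Formula α n m, ∀ w p S, ψ.Sat Set.univ w p S ↔
      ∃ δ : ℕ → κ, φ.Sat Set.univ (fun i => (w i, δ i)) p S := by
  obtain ⟨k, ⟨e⟩⟩ := Finite.exists_equiv_fin κ
  let h : κ → Fin (m + k) := fun d => (e d).castLE (Nat.le_add_left k m)
  obtain ⟨ψ, hψ⟩ := exists_sat_prod (D := Set.univ) φ (fun i : Fin m => i.addNat k) h
  -- `χ` puts a position into exactly one label set; required of all positions, it makes the `k`
  -- sets the fibres of a labelling.
  obtain ⟨χ, hχ⟩ : ∃ χ : Formula α (n + 1) (m + k), ∀ D w p S,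
      χ.Sat D w p S ↔ ∃ d, ∀ d', p 0 ∈ S (h d') ↔ d' = d := by
    classical
    choose χ hχ using fun d : κ => exists_sat_iff_forall_fintype
      (fun d' : κ => if d' = d then mem 0 (h d') else
        (not (mem 0 (h d')) : Formula α (n + 1) (m + k))) n.succ_pos
    obtain ⟨χ', hχ'⟩ := exists_sat_iff_exists_fintype χ n.succ_pos
    refine ⟨χ', fun D w p S => ?_⟩
    rw [hχ']
    refine exists_congr fun d => (hχ d D w p S).trans (forall_congr' fun d' => ?_)
    by_cases hd : d' = d <;> simp [hd]
  refine ⟨existsSets k (and (allPos χ) ψ), fun w p S => ?_⟩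
  simp only [sat_existsSets, sat_and, sat_allPos, hχ, Fin.cons_zero]
  constructor
  · rintro ⟨S', hS', hpart, hsat⟩
    choose δ hδ using hpart
    refine ⟨δ, ?_⟩
    have := (hψ w δ p S' fun d => by ext i; simp [hδ, eq_comm]).1 hsat
    rwa [show (S' ∘ fun i : Fin m => i.addNat k) = S from funext hS'] at this
  · rintro ⟨δ, hsat⟩
    let S' : Fin (m + k) → Set ℕ := fun j =>
      if hj : (j : ℕ) < k then {i | δ i = e.symm ⟨j, hj⟩} else S ⟨j - k, by omega⟩
    have hS' (i : Fin m) : S' (i.addNat k) = S i := by simp [S']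
    have hδ (d : κ) : S' (h d) = {i | δ i = d} := by simp [S', h]
    refine ⟨S', hS', fun x => ⟨δ x, fun d' => by simp [hδ, eq_comm]⟩, ?_⟩
    rw [hψ w δ p S' hδ]
    rwa [show (S' ∘ fun i : Fin m => i.addNat k) = S from funext hS']

theorem _root_.MSOU.WeakDefinable.fullDefinable {L : Set (ℕ → α)} (h : WeakDefinable L) :
    FullDefinable L := by
  obtain ⟨φ, rfl⟩ := h
  exact ⟨φ.relativize, Set.ext fun w => sat_relativize w φ _ _⟩

end MSOU.Formula

/-! ### Counter values as gains along traces -/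

namespace MaxAut

variable {α : Type u} {Q C : Type}

/-- The value of an optional counter; the value of `none` is `0`. -/
def optVal (v : C → ℕ) (d : Option C) : ℕ := d.elim 0 v

@[simp] theorem optVal_none (v : C → ℕ) : optVal v none = 0 := rfl

@[simp] theorem optVal_some (v : C → ℕ) (c : C) : optVal v (some c) = v c := rfl

theorem exec_append_singleton (ops : List (Op C)) (op : Op C) (v : C → ℕ) :
    exec (ops ++ [op]) v = op.apply (exec ops v) := by
  simp [exec]

/-- Every counter value after the execution of `ops` is the value of some optional counter before,
plus a constant, in a way that bounds it from below for all initial counter values. -/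
theorem exists_exec_eq (ops : List (Op C)) (v : C → ℕ) (e : Option C) :
    ∃ (d : Option C) (k : ℕ), k ≤ ops.length ∧ optVal (exec ops v) e = optVal v d + k ∧
      ∀ v' : C → ℕ, optVal v' d + k ≤ optVal (exec ops v') e := by
  induction ops using List.reverseRecOn generalizing e with
  | nil => exact ⟨e, 0, by simp [exec]⟩
  | append_singleton ops op ih =>
    -- All cases but an increment of `e` itself: the last operation copies some value and gains
    -- nothing. A reset copies from `none`.
    have weaken (e e' : Option C)
        (h : optVal (exec (ops ++ [op]) v) e' = optVal (exec ops v) e)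
        (h' : ∀ v', optVal (exec ops v') e ≤ optVal (exec (ops ++ [op]) v') e') :
        ∃ (d : Option C) (k : ℕ), k ≤ (ops ++ [op]).length ∧
          optVal (exec (ops ++ [op]) v) e' = optVal v d + k ∧
          ∀ v' : C → ℕ, optVal v' d + k ≤ optVal (exec (ops ++ [op]) v') e' := by
      obtain ⟨d, k, hk, heq, hle⟩ := ih e
      exact ⟨d, k, hk.trans (by simp), h.trans heq, fun v' => (hle v').trans (h' v')⟩
    simp only [exec_append_singleton] at weaken ⊢
    rcases e with _ | e
    · exact weaken none none rfl fun _ => le_rfl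
    cases op with
    | incr c =>
      by_cases hc : e = c
      · subst hc
        obtain ⟨d, k, hk, heq, hle⟩ := ih (some e)
        refine ⟨d, k + 1, by simpa using hk, ?_, fun v' => ?_⟩
        · simp only [Op.apply, optVal_some, Function.update_self] at heq ⊢
          omega
        · have := hle v'
          simp only [Op.apply, optVal_some, Function.update_self] at this ⊢
          omega
      · exact weaken (some e) (some e) (by simp [Op.apply, hc]) (by simp [Op.apply, hc])
    | reset c =>
      by_cases hc : e = c
      · exact weaken none (some e) (by simp [Op.apply, hc]) (by simp)
      · exact weaken (some e) (some e) (by simp [Op.apply, hc]) (by simp [Op.apply, hc])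
    | output c => exact weaken (some e) (some e) rfl fun _ => le_rfl
    | max c d =>
      by_cases hc : e = c
      · subst hc
        -- The trace follows the larger argument; the lower bound for other initial values holds for
        -- either one.
        rcases le_total (exec ops v e) (exec ops v d) with h | h
        · exact weaken (some d) (some e) (by simp [Op.apply, h]) (by simp [Op.apply])
        · exact weaken (some e) (some e) (by simp [Op.apply, h]) (by simp [Op.apply])
      · exact weaken (some e) (some e) (by simp [Op.apply, hc]) (by simp [Op.apply, hc])

theorem mem_outputs {ops : List (Op C)} {v : C → ℕ} {c : C} {k : ℕ} :
    (c, k) ∈ outputs ops v ↔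
      ∃ ops₁ ops₂, ops = ops₁ ++ Op.output c :: ops₂ ∧ k = exec ops₁ v c := by
  induction ops generalizing v with
  | nil => simp [outputs]
  | cons op ops ih =>
    have key : (∃ ops₁ ops₂, op :: ops = ops₁ ++ Op.output c :: ops₂ ∧ k = exec ops₁ v c) ↔
        (op = Op.output c ∧ k = v c) ∨ (c, k) ∈ outputs ops (op.apply v) := by
      rw [ih]
      constructor
      · rintro ⟨_ | ⟨op', ops₁⟩, ops₂, h, hk⟩
        · simp only [List.nil_append, List.cons.injEq] at h
          exact .inl ⟨h.1, hk⟩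
        · simp only [List.cons_append, List.cons.injEq] at h
          obtain ⟨rfl, h⟩ := h
          exact .inr ⟨ops₁, ops₂, h, hk⟩
      · rintro (⟨rfl, hk⟩ | ⟨ops₁, ops₂, rfl, hk⟩)
        · exact ⟨[], ops, rfl, hk⟩
        · exact ⟨op :: ops₁, ops₂, rfl, hk⟩
    rw [key]
    cases op with
    | output c' =>
      simp only [outputs, List.mem_cons, Prod.mk.injEq, Op.apply, Op.output.injEq]
      exact or_congr_left ⟨fun h => ⟨h.1.symm, h.1 ▸ h.2⟩, fun h => ⟨h.1.symm, h.1 ▸ h.2⟩⟩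
    | _ => simp [outputs]

/-- After the transition `t`, the optional counter `e` is at least `k` larger than `d` was
before. -/
def Transition.Flow (t : Transition α Q C) (k : ℕ) (d e : Option C) : Prop :=
  ∀ v : C → ℕ, optVal v d + k ≤ optVal (exec t.ops v) e

/-- The transition `t` outputs on the counter `c` a value that is at least the initial value of
the optional counter `d`. -/
def Transition.OutputsFrom (t : Transition α Q C) (c : C) (d : Option C) : Prop :=
  ∃ ops₁ ops₂, t.ops = ops₁ ++ Op.output c :: ops₂ ∧ ∀ v : C → ℕ, optVal v d ≤ exec ops₁ v c

/-- `δ` traces the flow of counter values from the beginning of the run `ρ` to position `i`,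
and the value is increased at all positions in `X`. -/
structure IsTrace (ρ : ℕ → Transition α Q C) (δ : ℕ → Option C) (i : ℕ) (X : Set ℕ) : Prop where
  flow : ∀ j < i, (ρ j).Flow 0 (δ j) (δ (j + 1))
  incr : ∀ j ∈ X, j < i ∧ (ρ j).Flow 1 (δ j) (δ (j + 1))

/-- The value along a trace never falls below its accumulated gain, which grows by at least one at
each position of `X`. -/
theorem IsTrace.ncard_le {ρ : ℕ → Transition α Q C} {δ : ℕ → Option C} {i : ℕ} {X : Set ℕ}
    (h : IsTrace ρ δ i X) : X.ncard ≤ optVal (counterVal ρ i) (δ i) := by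
  induction i generalizing X with
  | zero =>
    obtain rfl : X = ∅ := Set.eq_empty_of_forall_notMem fun j hj => by simpa using (h.incr j hj).1
    simp
  | succ i ih =>
    have h' : IsTrace ρ δ i (X \ {i}) := by
      refine ⟨fun j hj => h.flow j (by omega), fun j hj => ?_⟩
      have := h.incr j hj.1
      have hne : j ≠ i := hj.2
      exact ⟨by omega, this.2⟩
    have hle := ih h'
    by_cases hi : i ∈ X
    · have hfin : X.Finite := (Set.finite_Iio (i + 1)).subset fun j hj => (h.incr j hj).1
      have := Set.ncard_sdiff_singleton_add_one hi hfin
      have := (h.incr i hi).2 (counterVal ρ i)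
      change _ ≤ optVal (exec _ _) _
      omega
    · rw [Set.sdiff_singleton_eq_self hi] at hle
      exact hle.trans (h.flow i (by omega) (counterVal ρ i))

/-- The origin of the value is followed backwards by `exists_exec_eq`. Each transition contributes
at most `M`, and `X` collects those that contribute something. -/
theorem exists_isTrace {ρ : ℕ → Transition α Q C} {M : ℕ} (hM : ∀ i, (ρ i).ops.length ≤ M)
    (i : ℕ) (e : Option C) : ∃ δ X, δ i = e ∧ IsTrace ρ δ i X ∧ X.Finite ∧
      optVal (counterVal ρ i) e ≤ M * X.ncard := by
  induction i generalizing e with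
  | zero =>
    refine ⟨fun _ => e, ∅, rfl, ⟨by simp, by simp⟩, by simp, ?_⟩
    cases e <;> simp [counterVal]
  | succ i ih =>
    obtain ⟨d, k, hk, heq, hle⟩ := exists_exec_eq (ρ i).ops (counterVal ρ i) e
    obtain ⟨δ, X, rfl, hX, hfin, hval⟩ := ih d
    have hlt (j : ℕ) (hj : j < i) : Function.update δ (i + 1) e j = δ j :=
      Function.update_of_ne (by omega) _ _
    have hlt' (j : ℕ) (hj : j < i) : Function.update δ (i + 1) e (j + 1) = δ (j + 1) :=
      Function.update_of_ne (by omega) _ _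
    have hi : Function.update δ (i + 1) e i = δ i := Function.update_of_ne (by omega) _ _
    have hflow : ∀ j < i + 1, (ρ j).Flow 0 (Function.update δ (i + 1) e j)
        (Function.update δ (i + 1) e (j + 1)) := by
      intro j hj
      rcases Nat.lt_succ_iff_lt_or_eq.1 hj with hj | rfl
      · rw [hlt j hj, hlt' j hj]
        exact hX.flow j hj
      · rw [hi, Function.update_self]
        exact fun v => (Nat.add_le_add_left (Nat.zero_le k) _).trans (hle v)
    have hincr : ∀ j ∈ X, j < i + 1 ∧ (ρ j).Flow 1 (Function.update δ (i + 1) e j)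
        (Function.update δ (i + 1) e (j + 1)) := by
      intro j hj
      have := hX.incr j hj
      rw [hlt j this.1, hlt' j this.1]
      exact ⟨by omega, this.2⟩
    have hval' : optVal (counterVal ρ (i + 1)) e = optVal (counterVal ρ i) (δ i) + k := heq
    rcases Nat.eq_zero_or_pos k with rfl | hpos
    · exact ⟨Function.update δ (i + 1) e, X, by simp, ⟨hflow, hincr⟩, hfin, by omega⟩
    · refine ⟨Function.update δ (i + 1) e, insert i X, by simp, ⟨hflow, ?_⟩, hfin.insert i, ?_⟩
      · rintro j (rfl | hj)
        · rw [hi, Function.update_self]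
          exact ⟨by omega, fun v => (Nat.add_le_add_left hpos _).trans (hle v)⟩
        · exact hincr j hj
      · have hnot : i ∉ X := fun hi => lt_irrefl _ (hX.incr i hi).1
        rw [Set.ncard_insert_of_notMem hnot hfin, Nat.mul_add_one, hval']
        have := hM i
        omega

/-- The output on a counter is unbounded iff the traces to its outputs have unboundedly many
increments. -/
theorem not_bddAbove_outputValues_iff {ρ : ℕ → Transition α Q C} {M : ℕ}
    (hM : ∀ i, (ρ i).ops.length ≤ M) (c : C) :
    ¬ BddAbove (outputValues ρ c) ↔ ∀ k, ∃ X : Set ℕ,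
      (∃ δ i, (ρ i).OutputsFrom c (δ i) ∧ IsTrace ρ δ i X) ∧ X.Finite ∧ k ≤ X.ncard := by
  rw [not_bddAbove_iff]
  constructor
  · intro h k
    -- The extra `M` pays for the operations executed before the output inside the last transition.
    obtain ⟨n, ⟨i, hi⟩, hn⟩ := h (M * k + M)
    obtain ⟨ops₁, ops₂, hops, rfl⟩ := mem_outputs.1 hi
    obtain ⟨d, l, hl, heq, hle⟩ := exists_exec_eq ops₁ (counterVal ρ i) (some c)
    obtain ⟨δ, X, rfl, hX, hfin, hval⟩ := exists_isTrace hM i d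
    refine ⟨X, ⟨δ, i, ⟨ops₁, ops₂, hops, fun v => ?_⟩, hX⟩, hfin, ?_⟩
    · exact (Nat.le_add_right _ _).trans (hle v)
    · have hlM : l ≤ M := hl.trans (le_trans (by simp [hops]) (hM i))
      rw [optVal_some] at heq
      by_contra! hlt
      have := Nat.mul_le_mul_left M hlt.le
      omega
  · intro h n
    obtain ⟨X, ⟨δ, i, ⟨ops₁, ops₂, hops, hout⟩, hX⟩, -, hk⟩ := h (n + 1)
    refine ⟨_, ⟨i, mem_outputs.2 ⟨ops₁, ops₂, hops, rfl⟩⟩, ?_⟩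
    exact (hk.trans hX.ncard_le).trans (hout _)

end MaxAut

/-! ### Formulas for runs and acceptance -/

namespace MaxAut

open MSOU MSOU.Formula

variable {α : Type u} {Q C : Type}

/-- The formula for an acceptance condition, given formulas for its clauses. -/
def Cond.toFormula {β : Type u} (F : C → Formula β 0 0) : Cond C → Formula β 0 0
  | .bounded c => F c
  | .true => Formula.not (Formula.existsPos
      (Formula.and (Formula.le 0 0) (Formula.not (Formula.le 0 0))))
  | .not φ => (φ.toFormula F).not
  | .and φ ψ => (φ.toFormula F).and (ψ.toFormula F)

theorem Cond.sat_toFormula {β : Type u} {F : C → Formula β 0 0} {w : ℕ → β} {p S} {B : Set C}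
    (hF : ∀ c, (F c).Sat Set.univ w p S ↔ c ∈ B) (φ : Cond C) :
    (φ.toFormula F).Sat Set.univ w p S ↔ φ.Holds B := by
  induction φ with
  | bounded c => exact hF c
  | true => simp [toFormula, Holds]
  | not φ ih => simp [toFormula, Holds, ih]
  | and φ ψ ih ih' => simp [toFormula, Holds, ih, ih']

section

variable {β : Type u} [Finite β] [Finite C] (tr : β → Transition α Q C)

/-- Over words labelled by transitions via `tr` and by optional counters, the set variable is the
set of increments of a trace to an output on `c`. -/
noncomputable def traceFormula (c : C) : Formula (β × Option C) 0 1 :=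
  existsPos (and (labels (fun b _ => (tr b.1).OutputsFrom c b.2) 0 0)
    (and
      (allPos (allPos (imp (and (lt 1 2) (succ 1 0))
        (labels (fun b b' => (tr b.1).Flow 0 b.2 b'.2) 1 0))))
      (allPos (imp (mem 0 0) (and (lt 0 1)
        (allPos (imp (succ 1 0) (labels (fun b b' => (tr b.1).Flow 1 b.2 b'.2) 1 0))))))))

theorem sat_traceFormula {c : C} {w : ℕ → β} {δ : ℕ → Option C} {p S} :
    (traceFormula tr c).Sat Set.univ (fun i => (w i, δ i)) p S ↔
      ∃ i, (tr (w i)).OutputsFrom c (δ i) ∧ IsTrace (fun i => tr (w i)) δ i (S 0) := by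
  simp only [traceFormula, sat_existsPos, sat_and, sat_labels, sat_allPos, sat_imp, sat_lt,
    sat_succ, sat_mem, Fin.cons_zero, Fin.cons_one,
    show (2 : Fin 3) = Fin.succ 1 from rfl, Fin.cons_succ]
  refine exists_congr fun i => and_congr_right fun _ => ?_
  constructor
  · rintro ⟨h, h'⟩
    exact ⟨fun j hj => h j (j + 1) ⟨hj, rfl⟩, fun j hj => ⟨(h' j hj).1, (h' j hj).2 _ rfl⟩⟩
  · intro h
    refine ⟨fun j j' hj => ?_, fun j hj => ⟨(h.incr j hj).1, fun j' hj' => ?_⟩⟩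
    · obtain ⟨hj, rfl⟩ := hj
      exact h.flow j hj
    · subst hj'
      exact (h.incr j hj).2

/-- `Flow` and `OutputsFrom` quantify over all counter values, so they depend only on the labels and
are expressible by finite disjunctions. The trace is guessed inside the scope of `U`. -/
theorem exists_sat_iff_bddAbove {M : ℕ} (hM : ∀ b, (tr b).ops.length ≤ M) (c : C) :
    ∃ φ : Formula β 0 0, ∀ w p S, φ.Sat Set.univ w p S ↔
      BddAbove (outputValues (fun i => tr (w i)) c) := by
  obtain ⟨ψ, hψ⟩ := exists_sat_iff_exists_fun (traceFormula tr c)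
  refine ⟨not (unbounding ψ), fun w p S => ?_⟩
  rw [sat_not, sat_unbounding, not_iff_comm,
    not_bddAbove_outputValues_iff (fun i => hM (w i))]
  simp [hψ, sat_traceFormula]

end

/-- The word is a run of `A` on the first components of its letters. -/
noncomputable def runFormula [Finite α] (A : MaxAutomaton α Q C) :
    haveI := A.finite_transitions.to_subtype
    Formula (α × A.transitions) 0 0 :=
  haveI := A.finite_transitions.to_subtype
  and (allPos (imp (first 0) (labels (fun b _ => b.2.1.src ∈ A.initial) 0 0)))
    (and (allPos (labels (fun b _ => b.2.1.letter = b.1) 0 0))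
      (allPos (allPos (imp (succ 1 0) (labels (fun b b' => b.2.1.tgt = b'.2.1.src) 1 0)))))

theorem sat_runFormula [Finite α] {A : MaxAutomaton α Q C} {w : ℕ → α} {ρ : ℕ → A.transitions}
    {p S} : (runFormula A).Sat Set.univ (fun i => (w i, ρ i)) p S ↔
      A.IsRun w fun i => (ρ i : Transition α Q C) := by
  have := A.finite_transitions.to_subtype
  simp only [runFormula, sat_and, sat_labels, sat_allPos, sat_imp, sat_first, sat_succ,
    Fin.cons_zero, Fin.cons_one]
  constructor
  · rintro ⟨h₁, h₂, h₃⟩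
    exact ⟨h₁ 0 rfl, fun i => (ρ i).2, h₂, fun i => h₃ i _ rfl⟩
  · rintro ⟨h₁, -, h₂, h₃⟩
    refine ⟨?_, h₂, ?_⟩
    · rintro _ rfl
      exact h₁
    · rintro i _ rfl
      exact h₃ i

theorem Recognizable.fullDefinable [Finite α] {L : Set (ℕ → α)} (h : Recognizable L) :
    FullDefinable L := by
  obtain ⟨Q, C, _, _, A, rfl⟩ := h
  have := A.finite_transitions.to_subtype
  let tr : α × A.transitions → Transition α Q C := fun b => b.2
  obtain ⟨M, hM⟩ : ∃ M, ∀ b, (tr b).ops.length ≤ M := by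
    obtain ⟨M, hM⟩ := (Set.finite_range fun b => (tr b).ops.length).bddAbove
    exact ⟨M, fun b => hM ⟨b, rfl⟩⟩
  choose F hF using exists_sat_iff_bddAbove tr hM
  obtain ⟨φ, hφ⟩ := exists_sat_iff_exists_fun (and (runFormula A) (A.acc.toFormula F))
  refine ⟨φ, Set.ext fun w => (hφ w _ _).trans ?_⟩
  have key (ρ : ℕ → A.transitions) := Cond.sat_toFormula
    (B := {c | BddAbove (outputValues (fun i => (ρ i : Transition α Q C)) c)})
    (fun c => hF c (fun i => (w i, ρ i)) Fin.elim0 Fin.elim0) A.acc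
  simp only [sat_and, sat_runFormula, key]
  constructor
  · rintro ⟨ρ, h⟩
    exact ⟨_, h⟩
  · rintro ⟨ρ, h⟩
    exact ⟨fun i => ⟨ρ i, h.1.mem i⟩, h⟩

end MaxAut

/-! ### Borel complexity of weak MSO+U -/

open MeasureTheory

namespace MSOU

/-- Languages definable in weak MSO+U are Borel. -/
theorem WeakDefinable.measurableSet {α : Type u} [MeasurableSpace α] [MeasurableSingletonClass α]
    {L : Set (ℕ → α)} (h : WeakDefinable L) : MeasurableSet L := by
  obtain ⟨φ, rfl⟩ := h
  suffices h : ∀ {n m : ℕ} (φ : Formula α n m) (p : Fin n → ℕ) (S : Fin m → Set ℕ),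
      MeasurableSet {w | φ.Sat {X | X.Finite} w p S} from h φ _ _
  intro n m φ
  induction φ with
  | letter a x => exact fun p S => (measurableSet_singleton a).preimage (measurable_pi_apply (p x))
  | le x y => exact fun p S => MeasurableSet.const _
  | mem x X => exact fun p S => MeasurableSet.const _
  | not φ ih => exact fun p S => (ih p S).compl
  | and φ ψ ih ih' => exact fun p S => (ih p S).inter (ih' p S)
  | existsPos φ ih =>
    intro p S
    simp only [Formula.sat_existsPos, Set.ofPred_exists]
    exact MeasurableSet.iUnion fun x => ih _ _
  | existsSet φ ih =>
    intro p S
    have : {w | φ.existsSet.Sat {X | X.Finite} w p S} =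
        ⋃ X : Finset ℕ, {w | φ.Sat {X | X.Finite} w p (Fin.cons (X : Set ℕ) S)} := by
      ext w
      simp only [Set.mem_ofPred_eq, Formula.sat_existsSet, Set.mem_iUnion]
      exact ⟨fun ⟨X, hX, h⟩ => ⟨hX.toFinset, by simpa using h⟩,
        fun ⟨X, h⟩ => ⟨X, X.finite_toSet, h⟩⟩
    rw [this]
    exact MeasurableSet.iUnion fun X => ih _ _
  | unbounding φ ih =>
    intro p S
    have : {w | φ.unbounding.Sat {X | X.Finite} w p S} = ⋂ k : ℕ,
        ⋃ X : {X : Finset ℕ // k ≤ X.card},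
          {w | φ.Sat {X | X.Finite} w p (Fin.cons (X.1 : Set ℕ) S)} := by
      ext w
      simp only [Set.mem_ofPred_eq, Formula.sat_unbounding, Set.mem_iUnion, Set.mem_iInter,
        Subtype.exists]
      refine forall_congr' fun k => ⟨fun ⟨X, h, hX, hk⟩ => ?_, fun ⟨X, hk, h⟩ => ?_⟩
      · exact ⟨hX.toFinset, by rwa [← Set.ncard_eq_toFinset_card X hX], by simpa using h⟩
      · exact ⟨X, h, X.finite_toSet, by rwa [Set.ncard_coe_finset]⟩
    rw [this]
    exact MeasurableSet.iInter fun k => MeasurableSet.iUnion fun X => ih _ _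

end MSOU

/-! ### A set that is not Borel -/

namespace Branch

/-- The initial segment of length `n` of a sequence. -/
def seg {β : Type*} (y : ℕ → β) (n : ℕ) : List β := (List.range n).map y

theorem seg_eq_seg {β : Type*} {y y' : ℕ → β} {n n' : ℕ} :
    seg y n = seg y' n' ↔ n = n' ∧ ∀ i < n, y i = y' i := by
  constructor
  · intro h
    obtain rfl : n = n' := by simpa [seg] using congrArg List.length h
    exact ⟨rfl, by simpa [seg] using h⟩
  · rintro ⟨rfl, h⟩
    simpa [seg] using h

/-- The set `x` of codes contains the code of the pair of the initial segments of length `n`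
of `z` and of `x` itself. -/
def Accepts (x : ℕ → Bool) (z : ℕ → ℕ) (n : ℕ) : Prop :=
  x (Encodable.encode (seg z n, seg x n)) = true

/-- Acceptance at `n` reads only finitely many bits of `x`: the first `n` and the one at the
resulting code. -/
theorem isOpen_accepts (z : ℕ → ℕ) (n : ℕ) : IsOpen {x | Accepts x z n} := by
  rw [isOpen_iff_eventually]
  intro x hx
  have h (i : ℕ) : ∀ᶠ x' in nhds x, x' i = x i :=
    (continuous_apply i).continuousAt.eventually_mem ((isOpen_discrete {x i}).mem_nhds rfl)
  filter_upwards [h _, (Set.finite_Iio n).eventually_all.2 fun i _ => h i] with x' h₁ h₂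
  change x' _ = true
  rw [seg_eq_seg.2 ⟨rfl, h₂⟩, h₁]
  exact hx

/-- The sequence starts above `2` and increases by at least `2` in each step. -/
def Spaced (z : ℕ → ℕ) : Prop := 3 ≤ z 0 ∧ ∀ i, z i + 2 ≤ z (i + 1)

/-- The set of codes that accept all initial segments of some spaced sequence. -/
def branchSet : Set (ℕ → Bool) := {x | ∃ z, Spaced z ∧ ∀ n, Accepts x z n}

/-- Since every sequence arises from gaps, spaced sequences can parametrize any continuous image of
Baire space. -/
theorem exists_spaced (y : ℕ → ℕ) : ∃ z, Spaced z ∧ ∀ i, z (i + 1) - z i - 2 = y i := by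
  refine ⟨fun i => 3 + ∑ j ∈ Finset.range i, (y j + 2), ⟨by simp, fun i => ?_⟩, fun i => ?_⟩ <;>
  · simp only [Finset.sum_range_succ]
    omega

/-- The set `branchSet` is not Borel. -/
theorem not_measurableSet_branchSet : ¬ MeasurableSet branchSet := by
  intro hmeas
  have : PolishSpace Bool := by
    let := TopologicalSpace.metrizableSpaceMetric Bool
    infer_instance
  have hanalytic : AnalyticSet branchSetᶜ := hmeas.compl.analyticSet
  rw [AnalyticSet] at hanalytic
  obtain hempty | ⟨h, hcont, hrange⟩ := hanalytic
  · have : (fun _ => false) ∈ branchSetᶜ := by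
      rintro ⟨z, -, hz⟩
      exact Bool.false_ne_true (hz 0)
    rw [hempty] at this
    exact this
  classical
  let gap : (ℕ → ℕ) → ℕ → ℕ := fun z i => z (i + 1) - z i - 2
  have hgap : Continuous gap := by
    refine continuous_pi fun i => ?_
    have : Continuous fun q : ℕ × ℕ => q.1 - q.2 - 2 := continuous_of_discreteTopology
    exact this.comp (f := fun z : ℕ → ℕ => (z (i + 1), z i))
      ((continuous_apply (i + 1)).prodMk (continuous_apply i))
  -- The diagonal set: if `x` accepts `z` at every `n`, then `x` agrees up to `n` with `h (gap z')`
  -- for some `z'` agreeing with `z` up to `n`. Continuity then gives `x = h (gap z)`, so `x` lies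
  -- in `branchSet` iff it lies in the complement.
  let x : ℕ → Bool := fun m => decide (∃ z n, Spaced z ∧
    m = Encodable.encode (seg z n, seg (h (gap z)) n))
  have hx (z : ℕ → ℕ) (n : ℕ) : Accepts x z n ↔ ∃ z', Spaced z' ∧
      (∀ i < n, z i = z' i) ∧ ∀ i < n, x i = h (gap z') i := by
    simp only [Accepts, x, decide_eq_true_eq, Encodable.encode_inj, Prod.mk.injEq, seg_eq_seg]
    constructor
    · rintro ⟨z', n', hz', ⟨rfl, h₁⟩, -, h₂⟩
      exact ⟨z', hz', h₁, h₂⟩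
    · rintro ⟨z', hz', h₁, h₂⟩
      exact ⟨z', n, hz', ⟨rfl, h₁⟩, rfl, h₂⟩
  have key : x ∈ branchSet ↔ x ∈ Set.range h := by
    constructor
    · rintro ⟨z, hz, hacc⟩
      simp only [hx] at hacc
      choose z' hz' h₁ h₂ using hacc
      have hlim {β : Type} [TopologicalSpace β] [DiscreteTopology β] {y : ℕ → β} {y' : ℕ → ℕ → β}
          (hy : ∀ n, ∀ i < n, y i = y' n i) : Filter.Tendsto y' Filter.atTop (nhds y) := by
        rw [tendsto_pi_nhds]
        intro i
        refine tendsto_const_nhds.congr' ?_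
        filter_upwards [Filter.eventually_gt_atTop i] with n hn using hy n i hn
      exact ⟨gap z, tendsto_nhds_unique (((hcont.comp hgap).tendsto z).comp (hlim h₁)) (hlim h₂)⟩
    · rintro ⟨y, hy⟩
      obtain ⟨z, hz, hzy⟩ := exists_spaced y
      refine ⟨z, hz, fun n => (hx z n).2 ⟨z, hz, fun _ _ => rfl, fun i _ => ?_⟩⟩
      rw [show gap z = y from funext hzy, hy]
  rw [hrange] at key
  by_cases hmem : x ∈ branchSet
  · exact key.1 hmem hmem
  · exact hmem (key.2 hmem)

end Branch

/-! ### The separating language and its defining sentence -/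

namespace Branch

open MSOU MSOU.Formula

section Language

variable {α : Type u} (a : α) (w : ℕ → α)

/-- There is no pair of adjacent letters `a` that starts after `y` and not after `z`. -/
def SameBlock (y z : ℕ) : Prop := y ≤ z ∧ ¬ ∃ d, y < d ∧ d ≤ z ∧ w d = a ∧ w (d + 1) = a

/-- The numbers of letters `a` in the blocks of the positions in `Z`, up to these positions, are
unbounded. -/
def UnboundedCount (Z : Set ℕ) : Prop :=
  ∀ k : ℕ, ∃ Y : Set ℕ, (∃ z ∈ Z, ∀ y ∈ Y, w y = a ∧ SameBlock a w y z) ∧ Y.Finite ∧ k ≤ Y.ncard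

/-- The distances of the positions in `Z` to the beginnings of their blocks are unbounded. -/
def UnboundedDist (Z : Set ℕ) : Prop :=
  ∀ k : ℕ, ∃ Y : Set ℕ, (∃ z ∈ Z, ∀ y ∈ Y, SameBlock a w y z) ∧ Y.Finite ∧ k ≤ Y.ncard

/-- The infinite words in which some set of positions of the letter `a` has unboundedly many
letters `a` in its blocks, but boundedly many letters `a` occur only within a bounded distance. -/
def branchLanguage : Set (ℕ → α) :=
  {w | ∃ X : Set ℕ, (∀ x ∈ X, w x = a) ∧ UnboundedCount a w X ∧
    ∀ Z : Set ℕ, (∀ z ∈ Z, ∃ x ∈ X, SameBlock a w z x) →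
      ¬ UnboundedCount a w Z → ¬ UnboundedDist a w Z}

variable {n m : ℕ}

/-- The formula for `SameBlock`. -/
def sameBlockFormula (y z : Fin n) : Formula α n m :=
  and (le y z) (not (existsPos (and (lt y.succ 0) (and (le 0 z.succ) (and (letter a 0)
    (existsPos (and (succ 1 0) (letter a 0))))))))

/-- The formula for `UnboundedCount`, of the last bound set variable. -/
def countFormula : Formula α n (m + 1) :=
  unbounding (existsPos (and (mem 0 1)
    (allPos (imp (mem 0 0) (and (letter a 0) (sameBlockFormula a 0 1))))))

/-- The formula for `UnboundedDist`, of the last bound set variable. -/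
def distFormula : Formula α n (m + 1) :=
  unbounding (existsPos (and (mem 0 1) (allPos (imp (mem 0 0) (sameBlockFormula a 0 1)))))

/-- The sentence that defines `branchLanguage`. -/
def branchFormula : Formula α 0 0 :=
  existsSet (and (allPos (imp (mem 0 0) (letter a 0))) (and (countFormula a)
    (allSet (imp (allPos (imp (mem 0 0) (existsPos (and (mem 0 1) (sameBlockFormula a 1 0)))))
      (imp (not (countFormula a)) (not (distFormula a)))))))

variable {a w} {D : Set (Set ℕ)} {p : Fin n → ℕ}

@[simp] theorem sat_sameBlockFormula {y z : Fin n} {S : Fin m → Set ℕ} :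
    (sameBlockFormula a y z).Sat D w p S ↔ SameBlock a w (p y) (p z) := by
  simp [sameBlockFormula, SameBlock, Fin.cons_one]

@[simp] theorem sat_countFormula {S : Fin (m + 1) → Set ℕ} :
    (countFormula a).Sat D w p S ↔ UnboundedCount a w (S 0) := by
  simp [countFormula, UnboundedCount, Fin.cons_one]

@[simp] theorem sat_distFormula {S : Fin (m + 1) → Set ℕ} :
    (distFormula a).Sat D w p S ↔ UnboundedDist a w (S 0) := by
  simp [distFormula, UnboundedDist, Fin.cons_one]

theorem fullDefinable_branchLanguage (a : α) : FullDefinable (branchLanguage a) := by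
  refine ⟨branchFormula a, ?_⟩
  ext w
  change (branchFormula a).Sat Set.univ w _ _ ↔ _
  simp [branchFormula, branchLanguage, Fin.cons_one]

end Language

/-! ### Words coding families of finite sets -/

/-- The position at which the block of the finite set `F` starts. -/
def base (F : Finset ℕ) : ℕ := Finset.equivBitIndices.symm F ^ 2

variable {F F' : Finset ℕ} {r r' : ℕ}

/-- If `N` is the binary code of `F`, then `r < 2 ^ r ≤ N`, so `N ^ 2 + r + 1 < (N + 1) ^ 2`. Blocks
are therefore disjoint, with a gap between them. -/
theorem base_add_lt (h : base F < base F') (hr : r ∈ F) : base F + r + 1 < base F' := by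
  have hlt : Finset.equivBitIndices.symm F < Finset.equivBitIndices.symm F' :=
    lt_of_pow_lt_pow_left₀ 2 (Nat.zero_le _) h
  have hr' : r < Finset.equivBitIndices.symm F := by
    rw [Finset.equivBitIndices_symm_apply]
    exact r.lt_two_pow_self.trans_le
      (Finset.single_le_sum (f := fun i => 2 ^ i) (fun _ _ => Nat.zero_le _) hr)
  unfold base at *
  nlinarith

theorem base_add_inj {s : ℕ} (hs : s ∈ F) (hr : r ≤ s) (hr' : r' ∈ F')
    (h : base F + r = base F' + r') : F = F' ∧ r = r' := by
  rcases lt_trichotomy (base F) (base F') with hlt | heq | hlt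
  · have := base_add_lt hlt hs
    omega
  · exact ⟨Finset.equivBitIndices.symm.injective (Nat.pow_left_injective two_ne_zero heq),
      by omega⟩
  · have := base_add_lt hlt hr'
    omega

/-- A set that contains `0` and `1`, and no other two successive numbers. -/
structure IsNode (F : Finset ℕ) : Prop where
  zero_mem : 0 ∈ F
  one_mem : 1 ∈ F
  eq_zero : ∀ i ∈ F, i + 1 ∈ F → i = 0

section Word

variable {α : Type u} {a b : α} {T : Set (Finset ℕ)}

open Classical in
/-- The infinite word that consists of the characteristic words of the sets in `T`, placed in
disjoint blocks. -/
noncomputable def word (a b : α) (T : Set (Finset ℕ)) (p : ℕ) : α :=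
  if ∃ F ∈ T, ∃ r ∈ F, p = base F + r then a else b

theorem word_eq_iff (hab : a ≠ b) {p : ℕ} :
    word a b T p = a ↔ ∃ F ∈ T, ∃ r ∈ F, p = base F + r := by
  rw [word]
  split_ifs with h
  · exact iff_of_true rfl h
  · exact iff_of_false hab.symm h

theorem word_base_add_eq_iff (hab : a ≠ b) (hF : F ∈ T) {s : ℕ} (hs : s ∈ F) (hr : r ≤ s) :
    word a b T (base F + r) = a ↔ r ∈ F := by
  rw [word_eq_iff hab]
  constructor
  · rintro ⟨F', -, r', hr', h⟩
    obtain ⟨rfl, rfl⟩ := base_add_inj hs hr hr' h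
    exact hr'
  · exact fun h => ⟨F, hF, r, h, rfl⟩

/-- Letters of different blocks are never adjacent, and within a node only `0` and `1` are
successive. Thus the pairs mark the block starts. -/
theorem word_pair_iff (hab : a ≠ b) (hT : ∀ F ∈ T, IsNode F) {p : ℕ} :
    word a b T p = a ∧ word a b T (p + 1) = a ↔ ∃ F ∈ T, p = base F := by
  simp only [word_eq_iff hab]
  constructor
  · rintro ⟨⟨F, hF, r, hr, rfl⟩, F', hF', r', hr', h⟩
    rcases lt_trichotomy (base F) (base F') with hlt | heq | hlt
    · have := base_add_lt hlt hr
      omega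
    · obtain rfl : F = F' :=
        Finset.equivBitIndices.symm.injective (Nat.pow_left_injective two_ne_zero heq)
      obtain rfl : r' = r + 1 := by omega
      exact ⟨F, hF, by simp [(hT F hF).eq_zero r hr hr']⟩
    · have := base_add_lt hlt hr'
      omega
  · rintro ⟨F, hF, rfl⟩
    exact ⟨⟨F, hF, 0, (hT F hF).zero_mem, rfl⟩, F, hF, 1, (hT F hF).one_mem, rfl⟩

theorem sameBlock_iff (hab : a ≠ b) (hT : ∀ F ∈ T, IsNode F) (hF : F ∈ T) {s : ℕ} (hs : s ∈ F)
    (hr : r ≤ s) {y : ℕ} :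
    SameBlock a (word a b T) y (base F + r) ↔ ∃ r' ≤ r, y = base F + r' := by
  simp only [SameBlock, word_pair_iff hab hT]
  constructor
  · rintro ⟨hy, h⟩
    have : base F ≤ y := by
      by_contra! hlt
      exact h ⟨base F, hlt, by omega, F, hF, rfl⟩
    exact ⟨y - base F, by omega, by omega⟩
  · rintro ⟨r', hr', rfl⟩
    refine ⟨by omega, ?_⟩
    rintro ⟨_, h, h', F', hF', rfl⟩
    have := base_add_lt (F := F) (F' := F') (by omega) hs
    omega

theorem ncard_image_base_le {Y : Set ℕ} {G : Finset ℕ}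
    (h : ∀ y ∈ Y, ∃ i ∈ G, y = base F + i) : Y.ncard ≤ G.card := by
  have hsub : Y ⊆ (G.image (base F + ·) : Finset ℕ) := by
    intro y hy
    obtain ⟨i, hi, rfl⟩ := h y hy
    simpa using hi
  refine (Set.ncard_le_ncard hsub (Finset.finite_toSet _)).trans ?_
  rw [Set.ncard_coe_finset]
  exact Finset.card_image_le

/-- For each `i`, the positions with at most `i` letters before them in the blocks chosen by `X`
have bounded count, hence bounded distance; that bound is `B i`. -/
theorem exists_bound_of_word_mem (hab : a ≠ b) (hT : ∀ F ∈ T, IsNode F)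
    (h : word a b T ∈ branchLanguage a) :
    ∃ B : ℕ → ℕ, ∀ k, ∃ F ∈ T, ∃ r ∈ F, k ≤ (F.filter (· ≤ r)).card ∧
      ∀ i, ∀ r' ≤ r, (F.filter (· ≤ r')).card ≤ i → r' < B i := by
  obtain ⟨X, hX, hcount, hdist⟩ := h
  have hsub {F : Finset ℕ} (hF : F ∈ T) {s r : ℕ} (hs : s ∈ F) (hr : r ≤ s) {Y : Set ℕ}
      (hY : ∀ y ∈ Y, word a b T y = a ∧ SameBlock a (word a b T) y (base F + r)) :
      Y.ncard ≤ (F.filter (· ≤ r)).card := by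
    refine ncard_image_base_le (F := F) fun y hy => ?_
    obtain ⟨hy, hsb⟩ := hY y hy
    obtain ⟨r', hr', rfl⟩ := (sameBlock_iff hab hT hF hs hr).1 hsb
    exact ⟨r', by simp [hr', (word_base_add_eq_iff hab hF hs (hr'.trans hr)).1 hy], rfl⟩
  have hbound (i : ℕ) : ∃ B, ∀ F ∈ T, ∀ r ∈ F, base F + r ∈ X →
      ∀ r' ≤ r, (F.filter (· ≤ r')).card ≤ i → r' < B := by
    have := hdist {z | ∃ F ∈ T, ∃ r ∈ F, base F + r ∈ X ∧
      ∃ r' ≤ r, (F.filter (· ≤ r')).card ≤ i ∧ z = base F + r'} ?_ ?_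
    · simp only [UnboundedDist, not_forall] at this
      obtain ⟨B, hB⟩ := this
      refine ⟨B, fun F hF r hr hrX r' hr' hi => ?_⟩
      by_contra! hle
      refine hB ⟨Set.Icc (base F) (base F + r'),
        ⟨_, ⟨F, hF, r, hr, hrX, r', hr', hi, rfl⟩, fun y hy => ?_⟩, Set.finite_Icc _ _, ?_⟩
      · rw [sameBlock_iff hab hT hF hr hr']
        exact ⟨y - base F, by have := hy.2; omega, by have := hy.1; omega⟩
      · rw [← Finset.coe_Icc, Set.ncard_coe_finset, Nat.card_Icc]
        omega
    · rintro _ ⟨F, hF, r, hr, hrX, r', hr', -, rfl⟩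
      exact ⟨_, hrX, (sameBlock_iff hab hT hF hr le_rfl).2 ⟨r', hr', rfl⟩⟩
    · intro hunb
      obtain ⟨Y, ⟨_, ⟨F, hF, r, hr, -, r', hr', hi, rfl⟩, hY⟩, -, hk⟩ := hunb (i + 1)
      have := hsub hF hr hr' hY
      omega
  choose B hB using hbound
  refine ⟨B, fun k => ?_⟩
  obtain ⟨Y, ⟨x, hx, hY⟩, -, hk⟩ := hcount k
  obtain ⟨F, hF, r, hr, rfl⟩ := (word_eq_iff hab).1 (hX x hx)
  exact ⟨F, hF, r, hr, hk.trans (hsub hF hr le_rfl hY), fun i => hB i F hF r hr hx⟩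

/-- The set that codes the first `m` elements of the sequence `z`. -/
def fin (z : ℕ → ℕ) (m : ℕ) : Finset ℕ := {0, 1} ∪ (Finset.range m).image z

theorem mem_fin {z : ℕ → ℕ} {m i : ℕ} : i ∈ fin z m ↔ i = 0 ∨ i = 1 ∨ ∃ j < m, z j = i := by
  simp [fin]

theorem card_fin_le (z : ℕ → ℕ) (m : ℕ) : (fin z m).card ≤ m + 2 := by
  refine (Finset.card_union_le _ _).trans ?_
  have : ((Finset.range m).image z).card ≤ m := Finset.card_image_le.trans (by simp)
  have : ({0, 1} : Finset ℕ).card = 2 := rfl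
  omega

theorem Spaced.strictMono {z : ℕ → ℕ} (hz : Spaced z) : StrictMono z :=
  strictMono_nat_of_lt_succ fun i => by have := hz.2 i; omega

theorem Spaced.three_le {z : ℕ → ℕ} (hz : Spaced z) (i : ℕ) : 3 ≤ z i :=
  hz.1.trans (hz.strictMono.monotone (Nat.zero_le i))

/-- Starting at `3` or above and stepping by at least `2` prevents any adjacency besides that of `0`
and `1`. -/
theorem Spaced.isNode_fin {z : ℕ → ℕ} (hz : Spaced z) (m : ℕ) : IsNode (fin z m) := by
  refine ⟨by simp [mem_fin], by simp [mem_fin], fun i hi hi' => ?_⟩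
  rw [mem_fin] at hi hi'
  by_contra hne
  rcases hi' with hi' | hi' | ⟨j', -, hj'⟩
  · omega
  · omega
  have h3 := hz.three_le j'
  rcases hi with hi | hi | ⟨j, -, hj⟩
  · omega
  · omega
  have hlt : j < j' := hz.strictMono.lt_iff_lt.1 (by omega)
  have := hz.strictMono.monotone (Nat.succ_le_of_lt hlt)
  have := hz.2 j
  simp only [Nat.succ_eq_add_one] at *
  omega

/-- `X` consists of the letters in all blocks of segments of `z`. These blocks share their elements,
so a position beyond `z K` has at least `K` letters before it, in whichever block it lies. -/
theorem word_mem_of_spaced (hab : a ≠ b) (hT : ∀ F ∈ T, IsNode F) {z : ℕ → ℕ} (hz : Spaced z)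
    (hzT : ∀ m, fin z m ∈ T) : word a b T ∈ branchLanguage a := by
  have hinj {F : Finset ℕ} (k : ℕ) : ((fun j => base F + z j) '' Set.Iio k).ncard = k := by
    rw [Set.ncard_image_of_injective _ fun i j h => hz.strictMono.injective (Nat.add_left_cancel h),
      ← Finset.coe_range, Set.ncard_coe_finset, Finset.card_range]
  refine ⟨{x | ∃ m, ∃ r ∈ fin z m, x = base (fin z m) + r}, ?_, fun k => ?_, ?_⟩
  · rintro _ ⟨m, r, hr, rfl⟩
    exact (word_base_add_eq_iff hab (hzT m) hr le_rfl).2 hr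
  · have hk : z k ∈ fin z (k + 1) := mem_fin.2 (.inr (.inr ⟨k, by omega, rfl⟩))
    refine ⟨(fun j => base (fin z (k + 1)) + z j) '' Set.Iio k, ⟨_, ⟨k + 1, z k, hk, rfl⟩, ?_⟩,
      (Set.finite_Iio k).image _, (hinj k).ge⟩
    rintro _ ⟨j, hj, rfl⟩
    have hj : j < k := hj
    have hle : z j ≤ z k := hz.strictMono.monotone hj.le
    exact ⟨(word_base_add_eq_iff hab (hzT _) hk hle).2
      (mem_fin.2 (.inr (.inr ⟨j, by omega, rfl⟩))),
      (sameBlock_iff hab hT (hzT _) hk le_rfl).2 ⟨_, hle, rfl⟩⟩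
  · intro Z hZ hcount hdist
    simp only [UnboundedCount, not_forall] at hcount
    obtain ⟨K, hK⟩ := hcount
    -- At most `r' + 1` positions precede offset `r'` inclusively, so `z K + 2` of them force `z K <
    -- r'`.
    obtain ⟨Y, ⟨x, hx, hY⟩, -, hcard⟩ := hdist (z K + 2)
    obtain ⟨_, ⟨m, r, hr, rfl⟩, hsb⟩ := hZ x hx
    obtain ⟨r', hr', rfl⟩ := (sameBlock_iff hab hT (hzT m) hr le_rfl).1 hsb
    have hle : Y.ncard ≤ (Finset.range (r' + 1)).card := by
      refine ncard_image_base_le (F := fin z m) fun y hy => ?_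
      obtain ⟨i, hi, rfl⟩ := (sameBlock_iff hab hT (hzT m) hr hr').1 (hY y hy)
      exact ⟨i, by simpa [Nat.lt_succ_iff] using hi, rfl⟩
    rw [Finset.card_range] at hle
    have hKm : K < m := by
      have := hz.three_le K
      rcases mem_fin.1 hr with h | h | ⟨j, hj, rfl⟩
      · omega
      · omega
      · exact (hz.strictMono.lt_iff_lt.1 (show z K < z j by omega)).trans hj
    refine hK ⟨(fun j => base (fin z m) + z j) '' Set.Iio K, ⟨_, hx, ?_⟩,
      (Set.finite_Iio K).image _, (hinj K).ge⟩
    rintro _ ⟨j, hj, rfl⟩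
    have hj : j < K := hj
    have hlt : z j < z K := hz.strictMono hj
    exact ⟨(word_base_add_eq_iff hab (hzT _) hr (by omega)).2
      (mem_fin.2 (.inr (.inr ⟨j, by omega, rfl⟩))),
      (sameBlock_iff hab hT (hzT _) hr hr').2 ⟨_, by omega, rfl⟩⟩

end Word

end Branch

/-! ### Reduction of the non-Borel set to the language -/

namespace Branch

open MSOU

/-- The initial segments of spaced sequences that are accepted by the set `x` of codes. -/
def tree (x : ℕ → Bool) : Set (Finset ℕ) :=
  {F | ∃ z m, Spaced z ∧ F = fin z m ∧ ∀ n ≤ m, Accepts x z n}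

theorem isNode_of_mem_tree {x : ℕ → Bool} : ∀ F ∈ tree x, IsNode F := by
  rintro _ ⟨z, m, hz, rfl, -⟩
  exact hz.isNode_fin m

theorem isOpen_mem_tree (F : Finset ℕ) : IsOpen {x | F ∈ tree x} := by
  have : {x | F ∈ tree x} =
      ⋃ (z : ℕ → ℕ) (m : ℕ) (_ : Spaced z ∧ F = fin z m), ⋂ n ∈ Set.Iic m, {x | Accepts x z n} := by
    ext x
    simp [tree]
  rw [this]
  exact isOpen_iUnion fun z => isOpen_iUnion fun m => isOpen_iUnion fun _ =>
    (Set.finite_Iic m).isOpen_biInter fun n _ => isOpen_accepts z n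

theorem measurable_word {α : Type u} [MeasurableSpace α] (a b : α) :
    Measurable fun x : ℕ → Bool => word a b (tree x) := by
  classical
  refine measurable_pi_lambda _ fun p => Measurable.ite ?_ measurable_const measurable_const
  have : {x | ∃ F ∈ tree x, ∃ r ∈ F, p = base F + r} =
      ⋃ (F : Finset ℕ) (_ : ∃ r ∈ F, p = base F + r), {x | F ∈ tree x} := by
    ext x
    simp [and_comm]
  rw [this]
  exact (isOpen_iUnion fun F => isOpen_iUnion fun _ => isOpen_mem_tree F).measurableSet

theorem Accepts.congr {x : ℕ → Bool} {z z' : ℕ → ℕ} {n : ℕ} (h : ∀ i < n, z i = z' i)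
    (hz : Accepts x z n) : Accepts x z' n := by
  rwa [Accepts, ← seg_eq_seg.2 ⟨rfl, h⟩]

/-- Each clause of `Spaced` involves at most two coordinates, so it passes to limits. -/
theorem Spaced.of_forall_exists {z : ℕ → ℕ}
    (h : ∀ n, ∃ z', Spaced z' ∧ ∀ i < n, z' i = z i) : Spaced z := by
  refine ⟨?_, fun i => ?_⟩
  · obtain ⟨z', hz', h⟩ := h 1
    exact h 0 one_pos ▸ hz'.1
  · obtain ⟨z', hz', h⟩ := h (i + 2)
    rw [← h i (by omega), ← h (i + 1) (by omega)]
    exact hz'.2 i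

/-- Compactness: sequences that are bounded coordinatewise on longer and longer initial segments
agree on arbitrarily long initial segments with some limit sequence. -/
theorem exists_limit {B : ℕ → ℕ} {z : ℕ → ℕ → ℕ} (h : ∀ k, ∀ i < k, z k i ≤ B i) :
    ∃ y : ℕ → ℕ, ∀ n, ∃ k ≥ n, ∀ i < n, z k i = y i := by
  -- Only the first `k` coordinates of `z k` are controlled; zeros beyond them put the sequence into
  -- the compact box.
  let z' : ℕ → ℕ → ℕ := fun k i => if i < k then z k i else 0
  have hK : IsCompact (Set.pi Set.univ fun i => Set.Iic (B i)) :=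
    isCompact_univ_pi fun i => (Set.finite_Iic (B i)).isCompact
  obtain ⟨y, -, φ, hφ, hlim⟩ := hK.tendsto_subseq (x := z') fun k i _ => by
    by_cases hi : i < k
    · simpa [z', hi] using h k i hi
    · simp [z', hi]
  refine ⟨y, fun n => ?_⟩
  rw [tendsto_pi_nhds] at hlim
  have hev (i : ℕ) : ∀ᶠ j in Filter.atTop, z' (φ j) i = y i :=
    (hlim i).eventually_mem ((isOpen_discrete {y i}).mem_nhds rfl)
  obtain ⟨j, hj, hn⟩ := (((Set.finite_Iio n).eventually_all.2 fun i _ => hev i).and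
    (Filter.eventually_ge_atTop n)).exists
  have hφn : n ≤ φ j := hn.trans hφ.le_apply
  refine ⟨φ j, hφn, fun i hi => ?_⟩
  have := hj i hi
  simpa [z', hi.trans_le hφn] using this

/-- Membership of the word gives accepted segments of every length with `z i ≤ B (i + 2)`; a limit
of these is a branch. -/
theorem word_mem_branchLanguage_iff {α : Type u} {a b : α} (hab : a ≠ b) {x : ℕ → Bool} :
    word a b (tree x) ∈ branchLanguage a ↔ x ∈ branchSet := by
  constructor
  · intro h
    obtain ⟨B, hB⟩ := exists_bound_of_word_mem hab isNode_of_mem_tree h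
    have hB' (k : ℕ) : ∃ z, (Spaced z ∧ ∀ n ≤ k, Accepts x z n) ∧ ∀ i < k, z i ≤ B (i + 2) := by
      -- The elements `0`, `1` and `z 0, …, z (k - 1)` number at most `k + 2`, so `k + 3` elements
      -- up to `r` reach `z k`.
      obtain ⟨_, ⟨z, m, hz, rfl, hacc⟩, r, hr, hk, hbound⟩ := hB (k + 3)
      have hsmall {i s : ℕ} (hs : i < m → s < z i) :
          ((fin z m).filter (· ≤ s)).card ≤ i + 2 := by
        refine (Finset.card_le_card fun e he => ?_).trans (card_fin_le z i)
        rw [Finset.mem_filter, mem_fin] at he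
        rw [mem_fin]
        refine he.1.imp_right (Or.imp_right ?_)
        rintro ⟨j, hj, rfl⟩
        refine ⟨j, ?_, rfl⟩
        by_contra! hij
        have := hs (hij.trans_lt hj)
        have := hz.strictMono.monotone hij
        omega
      have hlarge : k < m ∧ z k ≤ r := by
        by_contra hcon
        have := hsmall (i := k) (s := r) fun hkm => by
          by_contra! hle
          exact hcon ⟨hkm, hle⟩
        omega
      refine ⟨z, ⟨hz, fun n hn => hacc n (by omega)⟩, fun i hi => ?_⟩
      have h3 := hz.three_le i
      have hle := hz.strictMono.monotone hi.le
      -- Just before `z i` there are at most `i + 2` elements, the two markers included.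
      have := hbound (i + 2) (z i - 1) (by omega) (hsmall fun _ => by omega)
      omega
    choose z hz hzB using hB'
    obtain ⟨y, hy⟩ := exists_limit hzB
    refine ⟨y, Spaced.of_forall_exists fun n => ?_, fun n => ?_⟩
    · obtain ⟨k, -, h⟩ := hy n
      exact ⟨z k, (hz k).1, h⟩
    · obtain ⟨k, hk, h⟩ := hy n
      exact ((hz k).2 n hk).congr h
  · rintro ⟨z, hz, hacc⟩
    exact word_mem_of_spaced hab isNode_of_mem_tree hz fun m =>
      ⟨z, m, hz, rfl, fun n _ => hacc n⟩

/-- The map sending `x` to the word of its tree is measurable, so a weak definition would make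
`branchSet` Borel as a preimage. -/
theorem not_weakDefinable_branchLanguage {α : Type u} {a b : α} (hab : a ≠ b) :
    ¬ WeakDefinable (branchLanguage a) := by
  intro h
  let : MeasurableSpace α := ⊤
  refine not_measurableSet_branchSet ?_
  convert h.measurableSet.preimage (measurable_word a b) using 1
  ext x
  exact (word_mem_branchLanguage_iff hab).symm

end Branch

theorem mainTheorem8 (α : Type*) [Finite α] :
    (∀ L : Set (ℕ → α), MSOU.WeakDefinable L → MSOU.FullDefinable L) ∧
    (Nontrivial α → ∃ L : Set (ℕ → α), MSOU.FullDefinable L ∧ ¬ MSOU.WeakDefinable L) ∧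
    (∀ L : Set (ℕ → α), MaxAut.Recognizable L → MSOU.FullDefinable L) := by
  refine ⟨fun L h => h.fullDefinable, fun h => ?_, fun L h => h.fullDefinable⟩
  obtain ⟨a, b, hab⟩ := h.exists_pair_ne
  exact ⟨Branch.branchLanguage a, Branch.fullDefinable_branchLanguage a,
    Branch.not_weakDefinable_branchLanguage hab⟩
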